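/- Let $\mathcal H$ be a separable complex Hilbert space and let $h$ be a self-adjoint operator on $\mathcal H$ with compact resolvent, with an orthonormal basis of eigenvectors $(\psi_j)_{j\in\mathcal J}$, $h\psi_j=e_j\psi_j$, the eigenvalues $e_j$ being listed in increasing order and repeated according to multiplicity, with $\mathcal J=\mathbb N$ or $\mathcal J=\{1,\dots,\dim\mathcal H\}$. Let $\mathcal H_N=\mathcal H^{\otimes N}$ and $H_N=\sum_{j=1}^N h_j$, where $h_j$ is $h$ acting on the $j$-th factor. For $\alpha\in\mathcal J^N$ put $\Psi_\alpha=\psi_{\alpha_1}\otimes\cdots\otimes\psi_{\alpha_N}$ and $E_\alpha=\sum_{j=1}^N e_{\alpha_j}$. For $E\in\mathrm{Spec}(H_N)$ let $P_E$ be the orthogonal projection onto the eigenspace of $H_N$ at $E$, and let the energy algebra $\mathcal A_N$ be the set of bounded operators $f(H_N)=\sum_{E\in\mathrm{Spec}(H_N)}f(E)P_E$ with $f$ bounded and continuous on $\mathrm{Spec}(H_N)$. A collision specification $(\mathcal C,U,\nu)$ consists of a compact metric space $\mathcal C$, a continuous one-to-one map $U$ from $\mathcal C$ to the unitary operators on $\mathcal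 H_2$, and a Borel probability measure $\nu$ on $\mathcal C$ that charges all nonempty open sets, such that: (i) each $U(\sigma)$ commutes with $H_2$; (ii) $U(\sigma_0)=1$ for some $\sigma_0$; (iii) $\{U(\sigma)\}=\{U(\sigma)^*\}$, and the map $\sigma\mapsto\sigma'$ with $U(\sigma')=U(\sigma)^*$ is measurable and preserves $\nu$; (iv) with $V(\phi\otimes\psi)=\psi\otimes\phi$, $\{U(\sigma)\}=\{VU(\sigma)V^*\}$, and the map $\sigma\mapsto\sigma'$ with $U(\sigma')=VU(\sigma)V^*$ is measurable and preserves $\nu$. It is ergodic if the commutant of $\{U(\sigma):\sigma\in\mathcal C\}$ is $\mathcal A_2$. For $i<j$ let $U_{i,j}(\sigma)$ be $U(\sigma)$ acting on the factors $i,j$ of $\mathcal H_N$, and let $\mathscr C_N$ be the commutant of $\{U_{i,j}(\sigma): 1\le i<j\le N,\ \sigma\in\mathcal C\}$. A nonzero orthogonal projection $P\in\mathscr C_N$ is minimal if every nonzero orthogonal projection $Q\in\mathscr C_N$ with $Q\le P$ equals $P$. An ergodic collision specification is fully ergodic (for $N$ particles) if $P_E$ is minimal in $\mathscr C_N$ for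 each $E\in\mathrm{Spec}(H_N)$. Indices $\alpha,\alpha'\in\mathcal J^N$ are adjacent if for some $i<j$ one has $e_{\alpha_i}+e_{\alpha_j}=e_{\alpha'_i}+e_{\alpha'_j}$ and $\alpha_k=\alpha'_k$ for all $k\ne i,j$; they are equivalent, $\alpha\sim\alpha'$, if they are joined by a finite chain of successively adjacent indices. Let $(\mathcal C,U,\nu)$ be an ergodic collision specification and let $N\ge2$. Then: 1. Each equivalence class is finite. For each $E\in\mathrm{Spec}(H_N)$, the minimal projections $P$ in $\mathscr C_N$ with $P\le P_E$ are precisely the operators $P=\sum_{\alpha\sim\alpha_0}|\Psi_\alpha\rangle\langle\Psi_\alpha|$ for some $\alpha_0\in\mathcal J^N$ with $H_N\Psi_{\alpha_0}=E\Psi_{\alpha_0}$. 2. Each minimal projection in $\mathscr C_N$ satisfies $P\le P_E$ for some $E\in\mathrm{Spec}(H_N)$, and $c\mapsto\sum_{\alpha\in c}|\Psi_\alpha\rangle\langle\Psi_\alpha|$ is a bijection from the set of equivalence classes in $\mathcal J^N$ onto the set of minimal projections in $\mathscr C_N$. 3. The following are equivalent: the collision specification is fully ergodic for $N$ particles; $\mathscr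 C_N=\mathcal A_N$; and, whenever $\alpha,\alpha'\in\mathcal J^N$ satisfy $E_\alpha=E_{\alpha'}$, one has $\alpha\sim\alpha'$. -/

import Mathlib

open scoped InnerProductSpace

noncomputable section

namespace QuantumKac

/-! ### The Hilbert tensor power

The tensor power `𝓗^{⊗N}` of a Hilbert space `𝓗` with orthonormal basis `(ψ_j)_{j ∈ J}` is realised
as `ℓ²(J^N)`: a vector is given by its coordinates in the orthonormal basis
`ψ_{α_1} ⊗ ⋯ ⊗ ψ_{α_N}`. -/

/-- The `N`-fold Hilbert tensor power, in coordinates. -/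
abbrev TensorPower (J : Type*) (N : ℕ) : Type _ :=
  lp (fun _ : Fin N → J => ℂ) 2

theorem enorm_sq_eq_tsum {A : Type*} (f : lp (fun _ : A => ℂ) 2) :
    ‖f‖ₑ ^ 2 = ∑' a, ‖f a‖ₑ ^ 2 := by
  have h2 : (0 : ℝ) < (2 : ENNReal).toReal := by norm_num
  have hs : HasSum (fun a => ‖f a‖ ^ 2) (‖f‖ ^ 2) := by
    have := lp.hasSum_norm h2 f
    simpa using this
  have e1 : ‖f‖ₑ ^ 2 = ENNReal.ofReal (‖f‖ ^ 2) := by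
    rw [ENNReal.ofReal_pow (norm_nonneg _), ofReal_norm]
  rw [e1, ← hs.tsum_eq, ENNReal.ofReal_tsum_of_nonneg (fun _ => by positivity) hs.summable]
  refine tsum_congr fun a => ?_
  rw [ENNReal.ofReal_pow (norm_nonneg _), ofReal_norm]

theorem memlp_of_tsum_enorm {A : Type*} {f : A → ℂ} {c : ENNReal} (hc : c ≠ ⊤)
    (h : ∑' a, ‖f a‖ₑ ^ 2 ≤ c) : Memℓp f 2 := by
  refine memℓp_gen ?_
  have h' : ∑' a, ENNReal.ofReal (‖f a‖ ^ 2) ≠ ⊤ := by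
    refine ne_top_of_le_ne_top hc (le_trans (le_of_eq (tsum_congr fun a => ?_)) h)
    rw [ENNReal.ofReal_pow (norm_nonneg _), ofReal_norm]
  have := ENNReal.summable_toReal h'
  refine this.congr fun a => ?_
  rw [ENNReal.toReal_ofReal (by positivity)]
  simp

theorem norm_le_of_enorm_sq {E F : Type*} [NormedAddCommGroup E] [NormedAddCommGroup F]
    {x : E} {y : F} {c : ℝ} (hc : 0 ≤ c) (h : ‖x‖ₑ ^ 2 ≤ ENNReal.ofReal c ^ 2 * ‖y‖ₑ ^ 2) :
    ‖x‖ ≤ c * ‖y‖ := by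
  have h1 : ENNReal.ofReal (‖x‖ ^ 2) ≤ ENNReal.ofReal ((c * ‖y‖) ^ 2) := by
    rw [ENNReal.ofReal_pow (norm_nonneg _), ofReal_norm, ENNReal.ofReal_pow (by positivity),
      ENNReal.ofReal_mul hc, ofReal_norm, mul_pow]
    exact h
  rw [ENNReal.ofReal_le_ofReal_iff (by positivity)] at h1
  exact le_of_sq_le_sq h1 (by positivity)

/-- Composition with an injective map of the index sets, `f ↦ f ∘ g`. -/
def pull {A B : Type*} (g : A → B) (hg : Function.Injective g) :
    lp (fun _ : B => ℂ) 2 →L[ℂ] lp (fun _ : A => ℂ) 2 :=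
  have key : ∀ f : lp (fun _ : B => ℂ) 2, ∑' a, ‖f (g a)‖ₑ ^ 2 ≤ ‖f‖ₑ ^ 2 := fun f => by
    rw [enorm_sq_eq_tsum]
    exact ENNReal.tsum_comp_le_tsum_of_injective hg fun b => ‖f b‖ₑ ^ 2
  LinearMap.mkContinuous
    { toFun := fun f => ⟨fun a => f (g a), memlp_of_tsum_enorm (by simp) (key f)⟩
      map_add' := fun _ _ => rfl
      map_smul' := fun _ _ => rfl } 1 (fun f => by
        refine norm_le_of_enorm_sq zero_le_one ?_
        rw [enorm_sq_eq_tsum, ENNReal.ofReal_one, one_pow, one_mul]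
        exact key f)

@[simp] theorem pull_apply {A B : Type*} (g : A → B) (hg : Function.Injective g)
    (f : lp (fun _ : B => ℂ) 2) (a : A) : pull g hg f a = f (g a) := rfl

/-- The multi-index obtained from `α` by replacing its `i`-th entry by `β 0` and its `j`-th entry
by `β 1`. -/
def insertPair {J : Type*} {N : ℕ} (i j : Fin N) (α : Fin N → J) (β : Fin 2 → J) : Fin N → J :=
  Function.update (Function.update α i (β 0)) j (β 1)

theorem insertPair_injective {J : Type*} {N : ℕ} {i j : Fin N} (hij : i ≠ j) (α : Fin N → J) :
    Function.Injective (insertPair i j α) := by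
  intro β β' h
  have h0 := congrFun h i
  have h1 := congrFun h j
  simp only [insertPair, Function.update_self, Function.update_of_ne hij] at h0 h1
  funext k
  fin_cases k
  · exact h0
  · exact h1

/-- A multi-index is the same as its `i`-th and `j`-th entries and the remaining entries. -/
def splitPair {J : Type*} {N : ℕ} {i j : Fin N} (hij : i ≠ j) :
    ({k : Fin N // k ≠ i ∧ k ≠ j} → J) × (Fin 2 → J) ≃ (Fin N → J) where
  toFun p k := if hi : k = i then p.2 0 else if hj : k = j then p.2 1 else p.1 ⟨k, hi, hj⟩
  invFun α := (fun k => α k, ![α i, α j])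
  left_inv p := by
    refine Prod.ext (funext fun k => ?_) (funext fun k => ?_)
    · simp [k.2.1, k.2.2]
    · fin_cases k <;> simp [hij.symm]
  right_inv α := by
    funext k
    by_cases hi : k = i
    · subst hi; simp
    · by_cases hj : k = j
      · subst hj; simp [hi]
      · simp [hi, hj]

theorem tsum_pairOp_le {J : Type*} {N : ℕ} {i j : Fin N} (hij : i ≠ j)
    (B : TensorPower J 2 →L[ℂ] TensorPower J 2) (f : TensorPower J N) :
    ∑' α : Fin N → J, ‖B (pull (insertPair i j α) (insertPair_injective hij α) f) ![α i, α j]‖ₑ ^ 2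
      ≤ ‖B‖ₑ ^ 2 * ‖f‖ₑ ^ 2 := by
  have hins : ∀ (r : {k : Fin N // k ≠ i ∧ k ≠ j} → J) (β β' : Fin 2 → J),
      insertPair i j (splitPair hij (r, β)) β' = splitPair hij (r, β') := by
    intro r β β'
    funext k
    by_cases hi : k = i
    · subst hi; simp [insertPair, splitPair, hij]
    · by_cases hj : k = j
      · subst hj; simp [insertPair, splitPair, hi]
      · simp [insertPair, splitPair, hi, hj]
  have hsi : ∀ r : {k : Fin N // k ≠ i ∧ k ≠ j} → J,
      Function.Injective fun β : Fin 2 → J => splitPair hij (r, β) := fun r β β' h => by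
    simpa using (splitPair hij).injective h
  have hpr : ∀ (r : {k : Fin N // k ≠ i ∧ k ≠ j} → J) (β : Fin 2 → J),
      ![splitPair hij (r, β) i, splitPair hij (r, β) j] = β := by
    intro r β
    funext k
    fin_cases k <;> simp [splitPair, hij.symm]
  have hterm : ∀ (r : {k : Fin N // k ≠ i ∧ k ≠ j} → J) (β : Fin 2 → J),
      pull (insertPair i j (splitPair hij (r, β))) (insertPair_injective hij _) f
        = pull _ (hsi r) f := by
    intro r β
    refine lp.ext (funext fun β' => ?_)
    simp [hins]
  rw [← (splitPair hij).tsum_eq, ENNReal.tsum_prod', enorm_sq_eq_tsum f,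
    ← (splitPair hij).tsum_eq (fun α => ‖f α‖ₑ ^ 2), ENNReal.tsum_prod', ← ENNReal.tsum_mul_left]
  refine ENNReal.tsum_le_tsum fun r => ?_
  have e1 : ∑' β : Fin 2 → J, ‖B (pull (insertPair i j (splitPair hij (r, β)))
      (insertPair_injective hij _) f)
        ![splitPair hij (r, β) i, splitPair hij (r, β) j]‖ₑ ^ 2 = ‖B (pull _ (hsi r) f)‖ₑ ^ 2 := by
    rw [enorm_sq_eq_tsum]
    refine tsum_congr fun β => ?_
    rw [hterm, hpr]
  have e2 : ∑' β : Fin 2 → J, ‖f (splitPair hij (r, β))‖ₑ ^ 2 = ‖pull _ (hsi r) f‖ₑ ^ 2 := by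
    rw [enorm_sq_eq_tsum]
    rfl
  rw [e1, e2, ← mul_pow]
  gcongr
  exact B.le_opENorm _

/-- The operator on the `N`-fold tensor power that applies the two-particle operator `B` to the
factors `i` and `j` (in this order) and is the identity on the other factors. -/
def pairOp {J : Type*} {N : ℕ} (i j : Fin N) (hij : i ≠ j)
    (B : TensorPower J 2 →L[ℂ] TensorPower J 2) : TensorPower J N →L[ℂ] TensorPower J N :=
  LinearMap.mkContinuous
    { toFun := fun f =>
        ⟨fun α => B (pull (insertPair i j α) (insertPair_injective hij α) f) ![α i, α j],
          memlp_of_tsum_enorm (ENNReal.mul_ne_top (by simp) (by simp)) (tsum_pairOp_le hij B f)⟩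
      map_add' := fun f g => by
        refine lp.ext (funext fun α => ?_)
        simp only [map_add, lp.coeFn_add, Pi.add_apply]
      map_smul' := fun c f => by
        refine lp.ext (funext fun α => ?_)
        simp only [map_smul, lp.coeFn_smul, Pi.smul_apply]
        rfl } ‖B‖ (fun f => by
        refine norm_le_of_enorm_sq (norm_nonneg _) ?_
        rw [enorm_sq_eq_tsum, ofReal_norm]
        exact tsum_pairOp_le hij B f)

theorem pairOp_apply {J : Type*} {N : ℕ} (i j : Fin N) (hij : i ≠ j)
    (B : TensorPower J 2 →L[ℂ] TensorPower J 2) (f : TensorPower J N) (α : Fin N → J) :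
    pairOp i j hij B f α =
      B (pull (insertPair i j α) (insertPair_injective hij α) f) ![α i, α j] := rfl

/-- The swap `φ ⊗ χ ↦ χ ⊗ φ` on the two-fold tensor power. -/
def swapOp (J : Type*) : TensorPower J 2 →L[ℂ] TensorPower J 2 :=
  pull (fun β => β ∘ Equiv.swap 0 1) (Equiv.swap (0 : Fin 2) 1).surjective.injective_comp_right

section ProductVectors

variable {H : Type*} [NormedAddCommGroup H] [InnerProductSpace ℂ H] {J : Type*}

theorem summable_prod_coord {N : ℕ} (a : Fin N → J → ℝ) (h0 : ∀ i j, 0 ≤ a i j)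
    (hs : ∀ i, Summable (a i)) : Summable fun α : Fin N → J => ∏ i, a i (α i) := by
  classical
  refine summable_of_sum_le (c := ∏ i, ∑' j, a i j)
    (fun α => Finset.prod_nonneg fun i _ => h0 i _) fun s => ?_
  calc ∑ α ∈ s, ∏ i, a i (α i)
      ≤ ∑ α ∈ Fintype.piFinset (fun i => s.image fun α => α i), ∏ i, a i (α i) := by
        refine Finset.sum_le_sum_of_subset_of_nonneg (fun α hα => ?_)
          fun α _ _ => Finset.prod_nonneg fun i _ => h0 i _
        rw [Fintype.mem_piFinset]
        exact fun i => Finset.mem_image_of_mem _ hα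
    _ = ∏ i, ∑ j ∈ s.image (fun α => α i), a i j := (Finset.prod_univ_sum _ _).symm
    _ ≤ ∏ i, ∑' j, a i j := Finset.prod_le_prod
        (fun i _ => Finset.sum_nonneg fun j _ => h0 i j)
        fun i _ => (hs i).sum_le_tsum _ fun j _ => h0 i j

/-- The product vector `φ_1 ⊗ ⋯ ⊗ φ_N`, with coordinates `∏ i, ⟪ψ_{α_i}, φ_i⟫`. -/
def tprod (ψ : HilbertBasis J ℂ H) {N : ℕ} (φ : Fin N → H) : TensorPower J N :=
  ⟨fun α => ∏ i, ⟪ψ (α i), φ i⟫_ℂ, memℓp_gen (by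
    have := summable_prod_coord (fun i j => ‖⟪ψ j, φ i⟫_ℂ‖ ^ 2) (fun _ _ => by positivity)
      (fun i => by
        have h := lp.hasSum_norm (p := 2) (by norm_num) (ψ.repr (φ i))
        simpa [ψ.repr_apply_apply] using h.summable)
    refine this.congr fun α => ?_
    simp [norm_prod, Finset.prod_pow])⟩

theorem tprod_apply (ψ : HilbertBasis J ℂ H) {N : ℕ} (φ : Fin N → H) (α : Fin N → J) :
    tprod ψ φ α = ∏ i, ⟪ψ (α i), φ i⟫_ℂ := rfl

/-- The defining property of the Hilbert tensor product on product vectors. -/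
theorem inner_tprod (ψ : HilbertBasis J ℂ H) {N : ℕ} (φ χ : Fin N → H) :
    ⟪tprod ψ φ, tprod ψ χ⟫_ℂ = ∏ i, ⟪φ i, χ i⟫_ℂ := by
  classical
  have h1 := lp.hasSum_inner (𝕜 := ℂ) (tprod ψ φ) (tprod ψ χ)
  have hT : Filter.Tendsto (fun s : Finset J => Fintype.piFinset fun _ : Fin N => s)
      Filter.atTop Filter.atTop := by
    refine Filter.tendsto_atTop_finset_of_monotone
      (fun s t hst => Fintype.piFinset_subset _ _ fun _ => hst) fun α => ?_
    exact ⟨Finset.univ.image α, by simp [Fintype.mem_piFinset]⟩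
  have h2 := Filter.Tendsto.comp h1 hT
  have h3 : Filter.Tendsto
      (fun s : Finset J => ∏ i : Fin N, ∑ j ∈ s, ⟪φ i, ψ j⟫_ℂ * ⟪ψ j, χ i⟫_ℂ)
      Filter.atTop (nhds (∏ i, ⟪φ i, χ i⟫_ℂ)) :=
    tendsto_finsetProd _ fun i _ => ψ.hasSum_inner_mul_inner (φ i) (χ i)
  refine tendsto_nhds_unique h2 (h3.congr fun s => ?_)
  rw [Finset.prod_univ_sum]
  refine Finset.sum_congr rfl fun α _ => ?_
  simp [tprod_apply, Finset.prod_mul_distrib, mul_comm]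

/-- `pairOp` acts on product vectors as it should: the coordinates of
`(B (φ_i ⊗ φ_j)) ⊗ (the other factors)`. -/
theorem pairOp_tprod (ψ : HilbertBasis J ℂ H) {N : ℕ} (i j : Fin N) (hij : i ≠ j)
    (B : TensorPower J 2 →L[ℂ] TensorPower J 2) (φ : Fin N → H) (α : Fin N → J) :
    pairOp i j hij B (tprod ψ φ) α = B (tprod ψ ![φ i, φ j]) ![α i, α j] *
      ∏ k ∈ (Finset.univ.erase i).erase j, ⟪ψ (α k), φ k⟫_ℂ := by
  have : pull (insertPair i j α) (insertPair_injective hij α) (tprod ψ φ) =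
      (∏ k ∈ (Finset.univ.erase i).erase j, ⟪ψ (α k), φ k⟫_ℂ) • tprod ψ ![φ i, φ j] := by
    refine lp.ext (funext fun β => ?_)
    simp only [pull_apply, tprod_apply, lp.coeFn_smul, Pi.smul_apply, smul_eq_mul,
      Fin.prod_univ_two]
    rw [← Finset.mul_prod_erase Finset.univ _ (Finset.mem_univ i),
      ← Finset.mul_prod_erase (Finset.univ.erase i) _
        (Finset.mem_erase.mpr ⟨hij.symm, Finset.mem_univ j⟩)]
    have e : ∏ k ∈ (Finset.univ.erase i).erase j, ⟪ψ (insertPair i j α β k), φ k⟫_ℂ =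
        ∏ k ∈ (Finset.univ.erase i).erase j, ⟪ψ (α k), φ k⟫_ℂ := by
      refine Finset.prod_congr rfl fun k hk => ?_
      simp only [Finset.mem_erase] at hk
      simp [insertPair, hk.1, hk.2.1]
    rw [e]
    simp [insertPair, hij]
    ring
  rw [pairOp_apply, this, map_smul]
  simp [lp.coeFn_smul, mul_comm]

end ProductVectors

/-! ### Unbounded operators through their graphs -/

section Graphs

variable {K : Type*} [NormedAddCommGroup K] [InnerProductSpace ℂ K]

/-- `R` is the resolvent `(z - T)⁻¹` of the operator `T` with graph `G`: it is bounded and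
everywhere defined, maps into the domain of `T`, and is a two-sided inverse of `z - T`. -/
def IsResolventAt (G : Submodule ℂ (K × K)) (z : ℂ) (R : K →L[ℂ] K) : Prop :=
  (∀ w, (R w, z • R w - w) ∈ G) ∧ ∀ x y, (x, y) ∈ G → R (z • x - y) = x

/-- The spectrum of the operator with graph `G`. -/
def graphSpectrum (G : Submodule ℂ (K × K)) : Set ℂ :=
  {z | ¬ ∃ R : K →L[ℂ] K, IsResolventAt G z R}

/-- The eigenspace `{x | T x = z x}` of the operator `T` with graph `G`. -/
def graphEigenspace (G : Submodule ℂ (K × K)) (z : ℂ) : Submodule ℂ K :=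
  G.comap (LinearMap.prod LinearMap.id (z • LinearMap.id))

end Graphs

/-! ### The system -/

/-- A single-particle Hamiltonian `h`, a self-adjoint operator with compact resolvent on the Hilbert
space `H`, with its eigenvalues `(e_j)` in increasing order, repeated according to multiplicity, and
an orthonormal basis `(ψ_j)` of eigenvectors, `h ψ_j = e_j ψ_j`.  The index set `J` is a linear order
all of whose initial segments `{j | j ≤ a}` are finite, that is, a copy of `ℕ` or of some
`{1, …, n}`. -/
structure SingleParticle (H : Type*) [NormedAddCommGroup H] [InnerProductSpace ℂ H]
    [CompleteSpace H] (J : Type*) [LinearOrder J] [LocallyFiniteOrderBot J] where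
  /-- the single-particle Hamiltonian, possibly unbounded -/
  h : H →ₗ.[ℂ] H
  selfAdjoint : IsSelfAdjoint h
  compactResolvent : ∃ (z : ℂ) (R : H →L[ℂ] H), IsResolventAt h.graph z R ∧ IsCompactOperator R
  /-- the eigenvalues -/
  e : J → ℝ
  monotone_e : Monotone e
  /-- the eigenbasis -/
  ψ : HilbertBasis J ℂ H
  eigen : ∀ j, (ψ j, (e j : ℂ) • ψ j) ∈ h.graph

namespace SingleParticle

variable {H : Type*} [NormedAddCommGroup H] [InnerProductSpace ℂ H] [CompleteSpace H]
  {J : Type*} [LinearOrder J] [LocallyFiniteOrderBot J] (S : SingleParticle H J)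

/-- The energy `E_α = ∑ e_{α_j}`. -/
def energy {N : ℕ} (α : Fin N → J) : ℝ := ∑ j, S.e (α j)

/-- The vector `Ψ_α = ψ_{α_1} ⊗ ⋯ ⊗ ψ_{α_N}`. -/
def Ψ {N : ℕ} (α : Fin N → J) : TensorPower J N := tprod S.ψ fun i => S.ψ (α i)

/-- The graph of the `N`-particle Hamiltonian `H_N = ∑_j h_j`, the closure of the operator that maps
`φ_1 ⊗ ⋯ ⊗ φ_N`, with all `φ_j` in the domain of `h`, to
`∑_j φ_1 ⊗ ⋯ ⊗ h φ_j ⊗ ⋯ ⊗ φ_N`. -/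
def hamiltonian (N : ℕ) : Submodule ℂ (TensorPower J N × TensorPower J N) :=
  (Submodule.span ℂ {p | ∃ φ : Fin N → S.h.domain,
    p = (tprod S.ψ fun i => (φ i : H),
      ∑ j, tprod S.ψ (Function.update (fun i => (φ i : H)) j (S.h (φ j))))}).topologicalClosure

/-- The energy shell at `E`. -/
def energyShell (N : ℕ) (E : ℂ) : Submodule ℂ (TensorPower J N) :=
  graphEigenspace (S.hamiltonian N) E

instance completeSpace_energyShell (N : ℕ) (E : ℂ) : CompleteSpace (S.energyShell N E) := by
  refine IsClosed.completeSpace_coe (hs := ?_)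
  have hc : IsClosed (S.hamiltonian N : Set (TensorPower J N × TensorPower J N)) :=
    Submodule.isClosed_topologicalClosure _
  exact hc.preimage (f := fun x : TensorPower J N => (x, E • x)) (by fun_prop)

/-- The orthogonal projection `P_E` onto the energy shell at `E`. -/
def energyProj (N : ℕ) (E : ℂ) : TensorPower J N →L[ℂ] TensorPower J N :=
  (S.energyShell N E).starProjection

/-- The spectrum of `H_N`. -/
def spec (N : ℕ) : Set ℂ := graphSpectrum (S.hamiltonian N)

/-- The energy algebra `𝒜_N`: the operators `∑_{E ∈ Spec(H_N)} f(E) P_E` (strong convergence) with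
`f` bounded and continuous on `Spec(H_N)`. -/
def energyAlgebra (N : ℕ) : Set (TensorPower J N →L[ℂ] TensorPower J N) :=
  {A | ∃ f : BoundedContinuousFunction (S.spec N) ℂ,
    ∀ x, HasSum (fun E : S.spec N => f E • S.energyProj N E x) (A x)}

/-- Adjacency of multi-indices. -/
def Adjacent {N : ℕ} (α α' : Fin N → J) : Prop :=
  ∃ i j : Fin N, i < j ∧ S.e (α i) + S.e (α j) = S.e (α' i) + S.e (α' j) ∧
    ∀ k, k ≠ i → k ≠ j → α k = α' k

/-- Equivalence of multi-indices: they are joined by a finite chain of adjacent ones. -/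
def indexSetoid (N : ℕ) : Setoid (Fin N → J) where
  r := Relation.ReflTransGen S.Adjacent
  iseqv :=
    { refl := fun _ => .refl
      symm := fun h => by
        induction h with
        | refl => exact .refl
        | tail _ hbc ih =>
          obtain ⟨i, j, hij, he, hk⟩ := hbc
          exact .head ⟨i, j, hij, he.symm, fun k hi hj => (hk k hi hj).symm⟩ ih
      trans := fun h h' => h.trans h' }

/-- The operator `∑_{α ∈ c} |Ψ_α⟩⟨Ψ_α|` for a finite set `c` of multi-indices. -/
def indexProj {N : ℕ} (c : Set (Fin N → J)) : TensorPower J N →L[ℂ] TensorPower J N :=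
  ∑ᶠ α ∈ c, InnerProductSpace.rankOne ℂ (S.Ψ α) (S.Ψ α)

end SingleParticle

/-- `P` is a minimal projection of the operator algebra `𝒞`. -/
def IsMinimalProjection {K : Type*} [NormedAddCommGroup K] [InnerProductSpace ℂ K]
    [CompleteSpace K] (𝒞 : Set (K →L[ℂ] K)) (P : K →L[ℂ] K) : Prop :=
  P ∈ 𝒞 ∧ IsStarProjection P ∧ P ≠ 0 ∧
    ∀ Q ∈ 𝒞, IsStarProjection Q → Q ≠ 0 → Q ≤ P → Q = P

/-- A collision specification `(C, U, ν)` with parameter space the compact metric space `C`. Of the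
map `U` only strong continuity is required, which norm continuity implies. -/
structure CollisionSpecification {H : Type*} [NormedAddCommGroup H] [InnerProductSpace ℂ H]
    [CompleteSpace H] {J : Type*} [LinearOrder J] [LocallyFiniteOrderBot J]
    (S : SingleParticle H J) (C : Type*) [MetricSpace C] [CompactSpace C] [MeasurableSpace C]
    [BorelSpace C] where
  /-- the collision operators -/
  U : C → unitary (TensorPower J 2 →L[ℂ] TensorPower J 2)
  continuous_U : ∀ x : TensorPower J 2,
    Continuous fun σ => (U σ : TensorPower J 2 →L[ℂ] TensorPower J 2) x
  injective_U : Function.Injective U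
  /-- the distribution of the collision parameter -/
  ν : MeasureTheory.Measure C
  isProbabilityMeasure : MeasureTheory.IsProbabilityMeasure ν
  isOpenPosMeasure : ν.IsOpenPosMeasure
  /-- each `U σ` commutes with `H_2`, that is, `U σ` maps the graph of `H_2` onto itself -/
  commutes : ∀ σ x y, (x, y) ∈ S.hamiltonian 2 ↔
    ((U σ : TensorPower J 2 →L[ℂ] TensorPower J 2) x,
      (U σ : TensorPower J 2 →L[ℂ] TensorPower J 2) y) ∈ S.hamiltonian 2
  exists_one : ∃ σ₀, U σ₀ = 1
  /-- time reversal -/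
  reversal : ∃ τ : C → C, (∀ σ, U (τ σ) = star (U σ)) ∧ MeasureTheory.MeasurePreserving τ ν ν
  /-- exchange of the two particles -/
  exchange : ∃ τ : C → C,
    (∀ σ, (U (τ σ) : TensorPower J 2 →L[ℂ] TensorPower J 2) =
      swapOp J * (U σ : TensorPower J 2 →L[ℂ] TensorPower J 2) * star (swapOp J)) ∧
    MeasureTheory.MeasurePreserving τ ν ν

namespace CollisionSpecification

variable {H : Type*} [NormedAddCommGroup H] [InnerProductSpace ℂ H] [CompleteSpace H]
  {J : Type*} [LinearOrder J] [LocallyFiniteOrderBot J] {S : SingleParticle H J}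
  {C : Type*} [MetricSpace C] [CompactSpace C] [MeasurableSpace C] [BorelSpace C]
  (K : CollisionSpecification S C)

/-- Ergodicity: the commutant of `{U σ}` is the energy algebra `𝒜_2`. -/
def IsErgodic : Prop :=
  Set.centralizer (Set.range fun σ => (K.U σ : TensorPower J 2 →L[ℂ] TensorPower J 2)) =
    S.energyAlgebra 2

/-- The commutant `𝒞_N` of the collision operators `U_{i,j}(σ)`, `i < j`. -/
def commutant (N : ℕ) : Set (TensorPower J N →L[ℂ] TensorPower J N) :=
  Set.centralizer {T | ∃ (i j : Fin N) (hij : i < j) (σ : C), T = pairOp i j hij.ne (K.U σ)}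

/-- Full ergodicity of the `N`-particle system: ergodicity at each energy `E ∈ Spec(H_N)`, which
means that `P_E` is minimal in `𝒞_N`. -/
def IsFullyErgodic (N : ℕ) : Prop :=
  K.IsErgodic ∧ ∀ E ∈ S.spec N, IsMinimalProjection (K.commutant N) (S.energyProj N E)

end CollisionSpecification

end QuantumKac

end

/-! In the coordinates of the product eigenbasis, $H_N$ is multiplication by $E_\alpha$, so $P_E$ is
multiplication by the indicator of the level set $\{E_\alpha=E\}$ and $\mathcal A_N$ consists of the
bounded functions of the energy. Ergodicity then says that a two-particle operator commuting with
all $U(\sigma)$ is diagonal, with a symbol depending only on $e_{\beta_1}+e_{\beta_2}$.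

Let $T\in\mathscr C_N$. Fix the indices outside the factors $i,j$, possibly differently on the left
and on the right. The resulting compression of $T$ to two factors commutes with every $U(\sigma)$,
because $U_{i,j}(\sigma)$ does not touch the fixed indices; hence it lies in $\mathcal A_2$
(`IsErgodic.compress_mem`). Two distinct multi-indices differ in some entry, and a pair of factors
containing that entry shows the corresponding matrix element of $T$ to be zero. So $T$ is diagonal,
and its symbol is equal at adjacent indices. Conversely, a diagonal operator with such a symbol
restricts, for each choice of fixed indices, to an element of $\mathcal A_2$, and so commutes with
each $U_{i,j}(\sigma)$. This is `IsErgodic.mem_commutant`.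

Projections in $\mathscr C_N$ are thus indicators of unions of equivalence classes, and the minimal
ones are the single classes (`IsErgodic.isMinimalProjection_iff`). Classes lie in energy levels,
which are finite because the resolvent of $h$ is compact. Both forms of full ergodicity say that
each energy level is one class. -/

noncomputable section

namespace QuantumKac

/-! ### Diagonal operators on `ℓ²` -/

section Diagonal

variable {A B : Type*}

/-- `T` is the operator of multiplication by the function `t`. -/
def IsDiagonal (T : lp (fun _ : A => ℂ) 2 →L[ℂ] lp (fun _ : A => ℂ) 2) (t : A → ℂ) : Prop :=
  ∀ x a, T x a = t a * x a

theorem exists_isDiagonal {t : A → ℂ} {M : ℝ} (hM : 0 ≤ M) (ht : ∀ a, ‖t a‖ ≤ M) :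
    ∃ T, IsDiagonal T t := by
  have key : ∀ x : lp (fun _ : A => ℂ) 2,
      ∑' a, ‖t a * x a‖ₑ ^ 2 ≤ ENNReal.ofReal M ^ 2 * ‖x‖ₑ ^ 2 := fun x => by
    rw [enorm_sq_eq_tsum, ← ENNReal.tsum_mul_left]
    refine ENNReal.tsum_le_tsum fun a => ?_
    rw [enorm_mul, mul_pow]
    gcongr
    rw [← ofReal_norm]
    exact ENNReal.ofReal_le_ofReal (ht a)
  refine ⟨LinearMap.mkContinuous
    { toFun := fun x => ⟨fun a => t a * x a,
        memlp_of_tsum_enorm (ENNReal.mul_ne_top (by simp) (by simp)) (key x)⟩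
      map_add' := fun x y => lp.ext (funext fun a => by
        simp only [lp.coeFn_add, Pi.add_apply, mul_add])
      map_smul' := fun c x => lp.ext (funext fun a => by
        simp only [lp.coeFn_smul, Pi.smul_apply, smul_eq_mul, RingHom.id_apply]; ring) } M
    (fun x => norm_le_of_enorm_sq hM ?_), fun x a => rfl⟩
  rw [enorm_sq_eq_tsum]
  exact key x

section

variable {T T' : lp (fun _ : A => ℂ) 2 →L[ℂ] lp (fun _ : A => ℂ) 2} {t t' : A → ℂ}

theorem IsDiagonal.ext (h : IsDiagonal T t) (h' : IsDiagonal T' t) : T = T' :=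
  ContinuousLinearMap.ext fun x => lp.ext (funext fun a => by rw [h, h'])

theorem IsDiagonal.mul (h : IsDiagonal T t) (h' : IsDiagonal T' t') :
    IsDiagonal (T * T') fun a => t a * t' a := fun x a => by
  rw [mul_apply_eq_comp, h, h', mul_assoc]

variable [DecidableEq A]

theorem IsDiagonal.apply_single (h : IsDiagonal T t) (a : A) : T (lp.single 2 a 1) a = t a := by
  simp [h _ a]

theorem IsDiagonal.unique (h : IsDiagonal T t) (h' : IsDiagonal T t') : t = t' :=
  funext fun a => by rw [← h.apply_single, h'.apply_single]

theorem IsDiagonal.star (h : IsDiagonal T t) : IsDiagonal (star T) fun a => star (t a) := by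
  intro x a
  have e : T (lp.single 2 a 1) = lp.single 2 a (t a) := lp.ext (funext fun b => by
    rw [h]
    by_cases hb : b = a
    · subst hb; simp
    · simp [lp.single_apply, hb])
  have h1 := ContinuousLinearMap.adjoint_inner_right T (lp.single 2 a (1 : ℂ)) x
  rw [e, lp.inner_single_left, lp.inner_single_left] at h1
  rw [ContinuousLinearMap.star_eq_adjoint]
  simpa [mul_comm] using h1

/-- An operator whose off-diagonal matrix elements vanish is diagonal. -/
theorem isDiagonal_of_offDiag (h : ∀ a b, a ≠ b → T (lp.single 2 b 1) a = 0) :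
    IsDiagonal T fun a => T (lp.single 2 a 1) a := by
  intro x a
  have h1 := ((lp.hasSum_single (p := 2) (by simp) x).mapL T).mapL
    (lp.evalCLM ℂ (fun _ : A => ℂ) 2 a)
  have e : ∀ b, T (lp.single 2 b (x b)) a = x b * T (lp.single 2 b 1) a := fun b => by
    have : lp.single 2 b (x b) = x b • lp.single (E := fun _ : A => ℂ) 2 b (1 : ℂ) := by
      rw [← lp.single_smul]; simp
    rw [this, map_smul]
    rfl
  have h2 : HasSum (fun b => x b * T (lp.single 2 b 1) a) (T x a) := by
    refine h1.congr_fun ?_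
    exact fun b => (e b).symm
  rw [h2.unique (hasSum_single a fun b hb => by rw [h a b hb.symm, mul_zero]), mul_comm]

theorem IsDiagonal.isStarProjection {c : Set A} (h : IsDiagonal T (c.indicator 1)) :
    IsStarProjection T := by
  constructor
  · refine (h.mul h).ext (t := _) ?_
    convert h using 1
    funext a
    by_cases ha : a ∈ c <;> simp [ha]
  · refine h.star.ext ?_
    convert h using 1
    funext a
    by_cases ha : a ∈ c <;> simp [ha]

/-- Idempotence gives $t^2=t$ pointwise, since the symbol is unique, so $t$ only takes the values 0
and 1. -/
theorem IsDiagonal.eq_indicator (h : IsDiagonal T t) (hT : IsStarProjection T) :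
    IsDiagonal T ({a | t a ≠ 0}.indicator 1) := by
  convert h using 1
  have h2 := hT.isIdempotentElem
  have h3 : IsDiagonal T fun a => t a * t a := by
    have := h.mul h
    rwa [h2.eq] at this
  have h4 := h3.unique h
  funext a
  by_cases ha : t a = 0
  · simp [ha]
  · have : t a = 1 := by simpa [ha] using congrFun h4 a
    simp [this]

theorem IsDiagonal.ne_zero_iff {c : Set A} (h : IsDiagonal T (c.indicator 1)) :
    T ≠ 0 ↔ c.Nonempty := by
  constructor
  · intro hT
    by_contra hc
    rw [Set.not_nonempty_iff_eq_empty] at hc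
    subst hc
    refine hT (h.ext fun x a => ?_)
    simp
  · rintro ⟨a, ha⟩ rfl
    have := h.apply_single a
    simp [ha] at this

/-- The order on projections is $TT'=T$, and the product of two indicators is the indicator of the
intersection. -/
theorem IsDiagonal.le_iff {c d : Set A} (h : IsDiagonal T (c.indicator 1))
    (h' : IsDiagonal T' (d.indicator 1)) : T ≤ T' ↔ c ⊆ d := by
  rw [h.isStarProjection.le_iff_mul_eq_left h'.isStarProjection]
  have e := h.mul h'
  constructor
  · intro he a ha
    rw [he] at e
    have := congrFun (e.unique h) a
    by_contra hd
    simp [ha, hd] at this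
  · intro hcd
    refine e.ext ?_
    convert h using 1
    funext a
    by_cases ha : a ∈ c
    · simp [ha, hcd ha]
    · simp [ha]

end

/-! ### Compressions to two factors -/

/-- Extension by zero along an injective map of the index sets. -/
def push (g : A → B) (hg : Function.Injective g) :
    lp (fun _ : A => ℂ) 2 →L[ℂ] lp (fun _ : B => ℂ) 2 :=
  ContinuousLinearMap.adjoint (pull g hg)

variable [DecidableEq B]

theorem push_apply_of_notMem (g : A → B) (hg : Function.Injective g) (x : lp (fun _ : A => ℂ) 2)
    {b : B} (hb : b ∉ Set.range g) : push g hg x b = 0 := by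
  have h := ContinuousLinearMap.adjoint_inner_right (pull g hg) (lp.single 2 b (1 : ℂ)) x
  have e : pull g hg (lp.single 2 b 1) = 0 := lp.ext (funext fun a => by
    have : g a ≠ b := fun h => hb ⟨a, h⟩
    simp [lp.single_apply, this])
  rw [e, lp.inner_single_left] at h
  simpa [push, eq_comm] using h

variable [DecidableEq A]

theorem push_apply (g : A → B) (hg : Function.Injective g) (x : lp (fun _ : A => ℂ) 2) (a : A) :
    push g hg x (g a) = x a := by
  have h := ContinuousLinearMap.adjoint_inner_right (pull g hg) (lp.single 2 (g a) (1 : ℂ)) x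
  have e : pull g hg (lp.single 2 (g a) 1) = lp.single 2 a 1 := lp.ext (funext fun b => by
    simp [lp.single_apply, Pi.single_apply, hg.eq_iff])
  rw [e, lp.inner_single_left, lp.inner_single_left] at h
  simpa [push] using h

theorem push_single (g : A → B) (hg : Function.Injective g) (a : A) :
    push g hg (lp.single 2 a 1) = lp.single 2 (g a) 1 := by
  refine lp.ext (funext fun b => ?_)
  by_cases hb : b ∈ Set.range g
  · obtain ⟨a', rfl⟩ := hb
    rw [push_apply]
    simp [lp.single_apply, Pi.single_apply, hg.eq_iff]
  · rw [push_apply_of_notMem _ _ _ hb]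
    have : b ≠ g a := fun h => hb ⟨a, h.symm⟩
    simp [lp.single_apply, this]

end Diagonal

/-! ### Operators on a pair of factors and compression to that pair -/

section PairIndex

variable {J : Type*} {N : ℕ} {i j : Fin N}

theorem insertPair_self (α : Fin N → J) : insertPair i j α ![α i, α j] = α := by
  simp [insertPair]

/-- The entries $i,j$ of the base index are overwritten; hence a fibre, and a compression to it,
depends only on the remaining entries. -/
theorem insertPair_congr {α γ : Fin N → J} (h : ∀ k, k ≠ i → k ≠ j → α k = γ k) :
    insertPair i j α = insertPair i j γ := by
  funext β k
  by_cases hj : k = j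
  · subst hj; simp [insertPair]
  · by_cases hi : k = i
    · subst hi; simp [insertPair, hj]
    · simp [insertPair, hi, hj, h k hi hj]

theorem insertPair_apply_of_ne (α : Fin N → J) (β : Fin 2 → J) {k : Fin N} (hi : k ≠ i)
    (hj : k ≠ j) : insertPair i j α β k = α k := by
  simp [insertPair, hi, hj]

theorem insertPair_entries (hij : i ≠ j) (α : Fin N → J) (β : Fin 2 → J) :
    ![insertPair i j α β i, insertPair i j α β j] = β := by
  funext k
  fin_cases k <;> simp [insertPair, hij]

theorem insertPair_insertPair (α : Fin N → J) (β : Fin 2 → J) :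
    insertPair i j (insertPair i j α β) = insertPair i j α :=
  insertPair_congr fun _ hi hj => insertPair_apply_of_ne α β hi hj

theorem pull_congr {A B : Type*} {g g' : A → B} (h : g = g') (hg : Function.Injective g)
    (hg' : Function.Injective g') : pull g hg = pull g' hg' := by
  subst h; rfl

/-- The pair operator acts separately on each fibre of fixed remaining indices, and acts there as
$B$. With its counterpart `pairOp_push` this lets $B$ pass through both sides of a compression. -/
theorem pull_pairOp (hij : i ≠ j) (B : TensorPower J 2 →L[ℂ] TensorPower J 2) (α : Fin N → J)
    (x : TensorPower J N) :
    pull (insertPair i j α) (insertPair_injective hij α) (pairOp i j hij B x) =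
      B (pull (insertPair i j α) (insertPair_injective hij α) x) := by
  refine lp.ext (funext fun β => ?_)
  rw [pull_apply, pairOp_apply, insertPair_entries hij,
    pull_congr (insertPair_insertPair α β) _ (insertPair_injective hij α)]

/-- The compression of an operator on `N` factors to the factors `i` and `j`, with the remaining
indices fixed to those of `α` on the left and of `γ` on the right. -/
def compress (hij : i ≠ j) (T : TensorPower J N →L[ℂ] TensorPower J N) (α γ : Fin N → J) :
    TensorPower J 2 →L[ℂ] TensorPower J 2 :=
  (pull (insertPair i j α) (insertPair_injective hij α)).comp
    (T.comp (push (insertPair i j γ) (insertPair_injective hij γ)))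

theorem compress_congr (hij : i ≠ j) (T : TensorPower J N →L[ℂ] TensorPower J N)
    {α γ : Fin N → J} (h : ∀ k, k ≠ i → k ≠ j → α k = γ k) :
    compress hij T α α = compress hij T γ γ := by
  simp only [compress, insertPair_congr h]

variable [DecidableEq J]

theorem pairOp_push (hij : i ≠ j) (B : TensorPower J 2 →L[ℂ] TensorPower J 2) (γ : Fin N → J)
    (x : TensorPower J 2) :
    pairOp i j hij B (push (insertPair i j γ) (insertPair_injective hij γ) x) =
      push (insertPair i j γ) (insertPair_injective hij γ) (B x) := by
  refine lp.ext (funext fun α => ?_)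
  rw [pairOp_apply]
  -- Either $\alpha$ lies in the fibre of $\gamma$, where both sides are a coordinate of $Bx$, or
  -- its fibre is disjoint from that of $\gamma$ and both sides vanish.
  by_cases h : ∀ k, k ≠ i → k ≠ j → α k = γ k
  · have e : pull (insertPair i j α) (insertPair_injective hij α)
        (push (insertPair i j γ) (insertPair_injective hij γ) x) = x :=
      lp.ext (funext fun β => by rw [pull_apply, insertPair_congr h, push_apply])
    rw [e]
    conv_rhs => rw [← insertPair_self (i := i) (j := j) α, insertPair_congr h, push_apply]
  · have hn : ∀ β, insertPair i j α β ∉ Set.range (insertPair i j γ) := by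
      rintro β ⟨β', hβ⟩
      refine h fun k hi hj => ?_
      rw [← insertPair_apply_of_ne α β hi hj, ← hβ, insertPair_apply_of_ne γ β' hi hj]
    have e : pull (insertPair i j α) (insertPair_injective hij α)
        (push (insertPair i j γ) (insertPair_injective hij γ) x) = 0 :=
      lp.ext (funext fun β => by rw [pull_apply, push_apply_of_notMem _ _ _ (hn β)]; rfl)
    rw [e, map_zero]
    have hα := hn ![α i, α j]
    rw [insertPair_self] at hα
    rw [push_apply_of_notMem _ _ _ hα]
    rfl

/-- Every matrix element of $T$ is a matrix element of some compression, for any chosen pair $i,j$;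
information on compressions therefore determines $T$. -/
theorem compress_apply_single (hij : i ≠ j) (T : TensorPower J N →L[ℂ] TensorPower J N)
    (α γ : Fin N → J) :
    compress hij T α γ (lp.single 2 ![γ i, γ j] 1) ![α i, α j] = T (lp.single 2 γ 1) α := by
  simp only [compress, ContinuousLinearMap.comp_apply, push_single, pull_apply, insertPair_self]

theorem compress_commute (hij : i ≠ j) {T : TensorPower J N →L[ℂ] TensorPower J N}
    {B : TensorPower J 2 →L[ℂ] TensorPower J 2}
    (h : pairOp i j hij B * T = T * pairOp i j hij B) (α γ : Fin N → J) :
    B * compress hij T α γ = compress hij T α γ * B := by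
  refine ContinuousLinearMap.ext fun x => ?_
  simp only [compress, mul_apply_eq_comp, ContinuousLinearMap.comp_apply]
  rw [← pull_pairOp hij, ← pairOp_push hij]
  have := congrArg (fun S => S (push (insertPair i j γ) (insertPair_injective hij γ) x)) h
  simp only [mul_apply_eq_comp] at this
  rw [this]

/-- Both operators preserve the fibres, so commutation can be tested fibre by fibre; on the fibre of
$\alpha$, $T$ restricts to its own compression, which serves as $D$. -/
theorem IsDiagonal.commute_pairOp (hij : i ≠ j) {T : TensorPower J N →L[ℂ] TensorPower J N}
    {t : (Fin N → J) → ℂ} (hT : IsDiagonal T t) {B : TensorPower J 2 →L[ℂ] TensorPower J 2}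
    (h : ∀ α, ∀ D : TensorPower J 2 →L[ℂ] TensorPower J 2,
      IsDiagonal D (fun β => t (insertPair i j α β)) → B * D = D * B) :
    pairOp i j hij B * T = T * pairOp i j hij B := by
  refine ContinuousLinearMap.ext fun x => lp.ext (funext fun α => ?_)
  have hpd : ∀ y, pull (insertPair i j α) (insertPair_injective hij α) (T y) =
      compress hij T α α (pull (insertPair i j α) (insertPair_injective hij α) y) := fun y =>
    lp.ext (funext fun β => by
      simp only [compress, ContinuousLinearMap.comp_apply, pull_apply, hT _ _, push_apply])
  have hD : IsDiagonal (compress hij T α α) fun β => t (insertPair i j α β) := fun y β => by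
    simp only [compress, ContinuousLinearMap.comp_apply, pull_apply, hT _ _, push_apply]
  have hB := congrArg
    (fun S => S (pull (insertPair i j α) (insertPair_injective hij α) x)) (h α _ hD)
  simp only [mul_apply_eq_comp] at hB
  rw [mul_apply_eq_comp, mul_apply_eq_comp, pairOp_apply, hpd, hB, hD,
    hT, pairOp_apply]
  simp only [insertPair_self]

end PairIndex

/-! ### The Hamiltonian in the eigenbasis -/

namespace SingleParticle

variable {H : Type*} [NormedAddCommGroup H] [InnerProductSpace ℂ H] [CompleteSpace H]
  {J : Type*} [LinearOrder J] [LocallyFiniteOrderBot J] (S : SingleParticle H J) {N : ℕ}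

theorem Ψ_eq_single (α : Fin N → J) : S.Ψ α = lp.single 2 α 1 := by
  refine lp.ext (funext fun β => ?_)
  have h := orthonormal_iff_ite.mp S.ψ.orthonormal
  simp only [Ψ, tprod_apply, h, Finset.prod_ite_zero, lp.single_apply, Pi.single_apply,
    funext_iff]
  simp

/-- Symmetry of $h$ moves it onto $\psi_j$, and $e_j$ is real. -/
theorem inner_ψ_h (j : J) (φ : S.h.domain) :
    ⟪S.ψ j, S.h φ⟫_ℂ = (S.e j : ℂ) * ⟪S.ψ j, (φ : H)⟫_ℂ := by
  have hs : S.h.IsFormalAdjoint S.h := by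
    have := LinearPMap.adjoint_isFormalAdjoint S.selfAdjoint.dense_domain
    rwa [LinearPMap.isSelfAdjoint_def.mp S.selfAdjoint] at this
  obtain ⟨y, hy1, hy2⟩ := (LinearPMap.mem_graph_iff _).mp (S.eigen j)
  have := hs y φ
  simp only at hy1 hy2
  rw [hy1, hy2, inner_smul_left, Complex.conj_ofReal] at this
  exact this.symm

theorem sum_tprod_update_apply (φ : Fin N → S.h.domain) (β : Fin N → J) :
    (∑ j, tprod S.ψ (Function.update (fun i => (φ i : H)) j (S.h (φ j))) : TensorPower J N) β =
      (S.energy β : ℂ) * tprod S.ψ (fun i => (φ i : H)) β := by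
  rw [lp.coeFn_sum, Finset.sum_apply]
  simp only [tprod_apply, energy, Complex.ofReal_sum, Finset.sum_mul]
  refine Finset.sum_congr rfl fun j _ => ?_
  rw [← Finset.mul_prod_erase _ _ (Finset.mem_univ j),
    ← Finset.mul_prod_erase _ (fun i => ⟪S.ψ (β i), (φ i : H)⟫_ℂ) (Finset.mem_univ j),
    Function.update_self, inner_ψ_h, mul_assoc]
  congr 2
  refine Finset.prod_congr rfl fun k hk => ?_
  rw [Function.update_of_ne (Finset.ne_of_mem_erase hk)]

theorem Ψ_mem_hamiltonian (α : Fin N → J) :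
    (S.Ψ α, (S.energy α : ℂ) • S.Ψ α) ∈ S.hamiltonian N := by
  refine Submodule.le_topologicalClosure _ (Submodule.subset_span ?_)
  have hd : ∀ j, S.ψ j ∈ S.h.domain := fun j => LinearPMap.mem_domain_of_mem_graph (S.eigen j)
  refine ⟨fun i => ⟨S.ψ (α i), hd _⟩, Prod.ext rfl (lp.ext (funext fun β => ?_))⟩
  have h := S.sum_tprod_update_apply (fun i => ⟨S.ψ (α i), hd (α i)⟩) β
  refine Eq.trans ?_ h.symm
  change (S.energy α : ℂ) * S.Ψ α β = (S.energy β : ℂ) * S.Ψ α β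
  by_cases hb : β = α
  · rw [hb]
  · simp [Ψ_eq_single, lp.single_apply, hb]

/-- In the eigenbasis, the Hamiltonian is multiplication by the energy on its maximal domain. -/
theorem mem_hamiltonian {p : TensorPower J N × TensorPower J N} :
    p ∈ S.hamiltonian N ↔ ∀ α, p.2 α = (S.energy α : ℂ) * p.1 α := by
  constructor
  · let ev : (Fin N → J) → TensorPower J N →L[ℂ] ℂ :=
      lp.evalCLM ℂ (fun _ : Fin N → J => ℂ) 2
    -- The coordinatewise conditions cut out a closed subspace, as coordinates are continuous; it
    -- contains the product vectors' pairs, hence the closure of their span.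
    let G : Submodule ℂ (TensorPower J N × TensorPower J N) :=
      ⨅ α, ((ev α).comp (ContinuousLinearMap.snd ℂ _ _) -
        (S.energy α : ℂ) • (ev α).comp (ContinuousLinearMap.fst ℂ _ _)).ker
    have hG : ∀ q, q ∈ G ↔ ∀ α, q.2 α = (S.energy α : ℂ) * q.1 α := fun q => by
      rw [Submodule.mem_iInf]
      refine forall_congr' fun α => ?_
      rw [LinearMap.mem_ker, ← sub_eq_zero (a := q.2 α)]
      rfl
    have hc : IsClosed (G : Set (TensorPower J N × TensorPower J N)) := by
      rw [Submodule.coe_iInf]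
      exact isClosed_iInter fun α => ContinuousLinearMap.isClosed_ker _
    intro hp
    refine (hG p).mp (Submodule.topologicalClosure_minimal _ (Submodule.span_le.mpr ?_) hc hp)
    rintro _ ⟨φ, rfl⟩
    exact (hG _).mpr fun α => S.sum_tprod_update_apply φ α
  · intro hp
    -- The pair $p$ is the limit of finite sums of multiples of $(\Psi_\alpha,E_\alpha\Psi_\alpha)$,
    -- and the graph is closed.
    have h := (lp.hasSum_single (p := 2) (by simp) p.1).prodMk
      (lp.hasSum_single (p := 2) (by simp) p.2)
    have hcl : IsClosed (S.hamiltonian N : Set (TensorPower J N × TensorPower J N)) :=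
      Submodule.isClosed_topologicalClosure _
    refine hcl.mem_of_tendsto h (Filter.Eventually.of_forall fun s => ?_)
    refine Submodule.sum_mem _ fun α _ => ?_
    convert Submodule.smul_mem _ (p.1 α) (S.Ψ_mem_hamiltonian α) using 1
    rw [hp, Ψ_eq_single, Prod.smul_mk, ← lp.single_smul, ← lp.single_smul, ← lp.single_smul]
    simp [mul_comm]

/-! ### Discreteness of the energies, spectrum and energy algebra -/

theorem exists_le_e : ∃ m, ∀ j, m ≤ S.e j := by
  rcases isEmpty_or_nonempty J with hJ | ⟨⟨a⟩⟩
  · exact ⟨0, fun j => hJ.elim j⟩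
  · obtain ⟨b, -, hb⟩ := (Finset.Iic a).exists_min_image S.e ⟨a, by simp⟩
    refine ⟨S.e b, fun j => ?_⟩
    rcases le_total j a with h | h
    · exact hb j (by simpa using h)
    · exact (hb a (by simp)).trans (S.monotone_e h)

/-- Compactness of the resolvent leaves finitely many eigenvalues below each level. -/
theorem finite_e_le (c : ℝ) : {j | S.e j ≤ c}.Finite := by
  by_contra hinf
  obtain ⟨m, hm⟩ := S.exists_le_e
  obtain ⟨z, R, hR, hRc⟩ := S.compactResolvent
  have hRψ : ∀ j, (z - S.e j) • R (S.ψ j) = S.ψ j := fun j => by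
    have := hR.2 _ _ (S.eigen j)
    rwa [← sub_smul, map_smul] at this
  have hne : ∀ j, S.ψ j ≠ 0 := S.ψ.orthonormal.ne_zero
  have hz : ∀ j, z - S.e j ≠ 0 := fun j h => hne j (by rw [← hRψ j, h, zero_smul])
  have hR' : ∀ j, R (S.ψ j) = (z - S.e j)⁻¹ • S.ψ j := fun j => by
    conv_rhs => rw [← hRψ j]
    rw [inv_smul_smul₀ (hz j)]
  -- $L$ bounds $|z-e_j|$ whenever $m\le e_j\le c$; the summand 1 makes it positive.
  set L : ℝ := ‖z‖ + |m| + |c| + 1 with hL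
  have hLpos : 0 < L := by positivity
  have hbound : ∀ j, S.e j ≤ c → L⁻¹ ≤ ‖(z - S.e j)⁻¹‖ := fun j hj => by
    rw [norm_inv]
    refine inv_anti₀ (norm_pos_iff.mpr (hz j)) ((norm_sub_le _ _).trans ?_)
    rw [Complex.norm_real, Real.norm_eq_abs]
    have : |S.e j| ≤ |m| + |c| := by
      rw [abs_le]
      have := hm j
      exact ⟨by linarith [neg_abs_le m, abs_nonneg c], by linarith [le_abs_self c, abs_nonneg m]⟩
    linarith
  -- Pairing $R\psi_j-R\psi_k$ with the unit vector $\psi_j$ leaves $(z-e_j)^{-1}$. Infinitely many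
  -- such $j$ would give a separated sequence in a compact set.
  have hsep : ∀ j k, S.e j ≤ c → j ≠ k → L⁻¹ ≤ dist (R (S.ψ j)) (R (S.ψ k)) := by
    intro j k hj hjk
    have ho := orthonormal_iff_ite.mp S.ψ.orthonormal
    have hi : ⟪S.ψ j, R (S.ψ j) - R (S.ψ k)⟫_ℂ = (z - S.e j)⁻¹ := by
      rw [inner_sub_right, hR', hR', inner_smul_right, inner_smul_right, ho, ho]
      simp [hjk]
    have hn := norm_inner_le_norm (𝕜 := ℂ) (S.ψ j) (R (S.ψ j) - R (S.ψ k))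
    rw [hi, S.ψ.orthonormal.1 j, one_mul, ← dist_eq_norm] at hn
    exact (hbound j hj).trans hn
  obtain ⟨Q, hQ, hQR⟩ := hRc.image_closedBall_subset_compact 1
  let u := Set.Infinite.natEmbedding _ hinf
  obtain ⟨a, -, θ, hθ, hlim⟩ := hQ.tendsto_subseq (x := fun n => R (S.ψ (u n)))
    fun n => hQR ⟨_, by simp [S.ψ.orthonormal.1], rfl⟩
  obtain ⟨n, hn⟩ := Metric.cauchySeq_iff'.mp hlim.cauchySeq L⁻¹ (by positivity)
  have h1 := hn (n + 1) (by omega)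
  refine absurd h1 (not_lt.mpr (hsep _ _ (u (θ (n + 1))).2 fun h => ?_))
  have := hθ.injective (u.injective (Subtype.ext h))
  omega

theorem finite_energy_le (N : ℕ) (c : ℝ) : {α : Fin N → J | S.energy α ≤ c}.Finite := by
  obtain ⟨m, hm⟩ := S.exists_le_e
  -- The differences $e_{\alpha_k}-m$ are nonnegative with sum at most $c-Nm$, so each is at most
  -- $c-Nm$.
  refine (Set.Finite.pi fun _ : Fin N => S.finite_e_le (c - N * m + m)).subset fun α hα => ?_
  intro i _
  have h1 := Finset.single_le_sum (f := fun i => S.e (α i) - m)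
    (fun i _ => sub_nonneg.mpr (hm _)) (Finset.mem_univ i)
  rw [Finset.sum_sub_distrib] at h1
  simp only [Finset.sum_const, Finset.card_univ, Fintype.card_fin, nsmul_eq_mul] at h1
  have h2 : ∑ i, S.e (α i) ≤ c := hα
  change S.e (α i) ≤ _
  linarith

/-- The energies form a closed discrete set. -/
theorem exists_energy_gap (N : ℕ) (z : ℂ) :
    ∃ δ > 0, ∀ α : Fin N → J, (S.energy α : ℂ) ≠ z → δ ≤ ‖z - S.energy α‖ := by
  -- Energies above $|z|+1$ are at distance more than 1 from $z$, so only finitely many others can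
  -- be close.
  have hF : ((fun α : Fin N → J => (S.energy α : ℂ)) '' {α | S.energy α ≤ ‖z‖ + 1} \ {z}).Finite :=
    ((S.finite_energy_le N _).image _).subset Set.sdiff_subset
  obtain ⟨δ, hδ, hball⟩ := Metric.isOpen_iff.mp hF.isClosed.isOpen_compl z (by simp)
  refine ⟨min δ 1, by positivity, fun α hα => ?_⟩
  by_contra! h
  have h1 : (S.energy α : ℂ) ∈ Metric.ball z δ := by
    rw [Metric.mem_ball, dist_comm, dist_eq_norm]
    exact h.trans_le (min_le_left _ _)
  refine hball h1 ⟨⟨α, ?_, rfl⟩, hα⟩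
  have h2 := norm_sub_norm_le (S.energy α : ℂ) z
  rw [norm_sub_rev, Complex.norm_real] at h2
  have h3 := h.trans_le (min_le_right _ _)
  have h4 := Real.le_norm_self (S.energy α)
  change S.energy α ≤ _
  linarith

/-- Off the energies, the gap bounds $(z-E_\alpha)^{-1}$, which is then the symbol of a resolvent;
at an energy, $z-H_N$ kills some $\Psi_\alpha$ and has no left inverse. -/
theorem mem_spec {z : ℂ} : z ∈ S.spec N ↔ ∃ α : Fin N → J, (S.energy α : ℂ) = z := by
  constructor
  · intro hz
    by_contra! h
    obtain ⟨δ, hδ, hgap⟩ := S.exists_energy_gap N z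
    obtain ⟨R, hR⟩ := exists_isDiagonal (t := fun α : Fin N → J => (z - S.energy α)⁻¹)
      (M := δ⁻¹) (by positivity) fun α => by
        rw [norm_inv]
        exact inv_anti₀ hδ (hgap α (h α))
    have hne : ∀ α : Fin N → J, z - S.energy α ≠ 0 := fun α => sub_ne_zero.mpr (h α).symm
    refine hz ⟨R, fun w => S.mem_hamiltonian.mpr fun α => ?_, fun x y hxy => ?_⟩
    · simp only [lp.coeFn_sub, lp.coeFn_smul, Pi.sub_apply, Pi.smul_apply, smul_eq_mul, hR w α]
      have := hne α
      field_simp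
      ring
    · refine lp.ext (funext fun α => ?_)
      have := S.mem_hamiltonian.mp hxy α
      simp only at this
      rw [hR]
      simp only [lp.coeFn_sub, lp.coeFn_smul, Pi.sub_apply, Pi.smul_apply, smul_eq_mul, this]
      rw [← sub_mul, inv_mul_cancel_left₀ (hne α)]
  · rintro ⟨α, rfl⟩ ⟨R, hR⟩
    have h := hR.2 _ _ (S.Ψ_mem_hamiltonian α)
    rw [sub_self, map_zero, Ψ_eq_single] at h
    have := congrArg (fun x : TensorPower J N => x α) h
    simp at this

theorem mem_energyShell {z : ℂ} {x : TensorPower J N} :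
    x ∈ S.energyShell N z ↔ ∀ α, z * x α = (S.energy α : ℂ) * x α :=
  S.mem_hamiltonian

theorem isDiagonal_energyProj (N : ℕ) (z : ℂ) :
    IsDiagonal (S.energyProj N z) ({α | (S.energy α : ℂ) = z}.indicator 1) := by
  classical
  obtain ⟨D, hD⟩ := exists_isDiagonal
    (t := ({α : Fin N → J | (S.energy α : ℂ) = z}.indicator 1 : (Fin N → J) → ℂ))
    zero_le_one fun α => by
      by_cases h : (S.energy α : ℂ) = z <;> simp [h]
  have : S.energyProj N z = D := by
    refine ContinuousLinearMap.ext fun x => ?_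
    refine Submodule.eq_starProjection_of_mem_of_inner_eq_zero ?_ fun w hw => ?_
    · refine S.mem_energyShell.mpr fun α => ?_
      rw [hD]
      by_cases h : (S.energy α : ℂ) = z
      · rw [h]
      · simp [h]
    · rw [lp.inner_eq_tsum]
      refine (tsum_congr fun α => ?_).trans tsum_zero
      rw [lp.coeFn_sub, Pi.sub_apply, hD]
      by_cases h : (S.energy α : ℂ) = z
      · simp [h]
      · have hw' := S.mem_energyShell.mp hw α
        rw [← sub_eq_zero, ← sub_mul, mul_eq_zero, sub_eq_zero] at hw'
        simp [hw'.resolve_left (Ne.symm h)]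
  rwa [this]

/-- Every function on the spectrum is then continuous, so only boundedness constrains $f$ in the
energy algebra. -/
instance discreteTopology_spec : DiscreteTopology (S.spec N) := by
  refine discreteTopology_iff_isOpen_singleton.mpr fun z => Metric.isOpen_iff.mpr fun w hw => ?_
  obtain ⟨δ, hδ, hgap⟩ := S.exists_energy_gap N z
  rw [Set.mem_singleton_iff.mp hw]
  refine ⟨δ, hδ, fun w hw => ?_⟩
  obtain ⟨α, hα⟩ := S.mem_spec.mp w.2
  by_contra hne
  have := hgap α fun h => hne (Subtype.ext (hα.symm.trans h))
  rw [hα, ← dist_eq_norm, dist_comm] at this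
  exact absurd (Metric.mem_ball.mp hw) (not_lt.mpr this)

/-- The energy algebra consists of the bounded functions of the energy. -/
theorem mem_energyAlgebra {A : TensorPower J N →L[ℂ] TensorPower J N} :
    A ∈ S.energyAlgebra N ↔ ∃ f : ℂ → ℂ, IsDiagonal A fun α => f (S.energy α) := by
  classical
  constructor
  · rintro ⟨f, hf⟩
    refine ⟨fun z => if h : z ∈ S.spec N then f ⟨z, h⟩ else 0, fun x α => ?_⟩
    have hα : (S.energy α : ℂ) ∈ S.spec N := S.mem_spec.mpr ⟨α, rfl⟩
    have h1 := (hf x).mapL (lp.evalCLM ℂ (fun _ : Fin N → J => ℂ) 2 α)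
    have h2 : HasSum (fun E : S.spec N => f E * S.energyProj N E x α) (A x α) := h1
    rw [h2.unique (hasSum_single ⟨S.energy α, hα⟩ fun E hE => ?_), S.isDiagonal_energyProj]
    · simp [hα]
    · rw [S.isDiagonal_energyProj]
      have : (S.energy α : ℂ) ≠ E := fun h => hE (Subtype.ext h.symm)
      simp [this]
  · rintro ⟨f, hf⟩
    -- Each $f(E)$ is a diagonal matrix element of $A$.
    have hbd : ∀ E : S.spec N, ‖f E‖ ≤ ‖A‖ := fun E => by
      obtain ⟨α, hα⟩ := S.mem_spec.mp E.2
      have h1 := lp.norm_apply_le_norm (p := 2) (by simp) (A (lp.single 2 α 1)) α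
      have h2 := A.le_opNorm (lp.single 2 α 1)
      rw [hf.apply_single, hα] at h1
      rw [lp.norm_single (by simp), norm_one, mul_one] at h2
      exact h1.trans h2
    refine ⟨BoundedContinuousFunction.ofNormedAddCommGroupDiscrete (fun E : S.spec N => f E)
      ‖A‖ hbd, fun x => ?_⟩
    let en : (Fin N → J) → S.spec N := fun α => ⟨S.energy α, S.mem_spec.mpr ⟨α, rfl⟩⟩
    have h := lp.hasSum_single (p := 2) (by simp) (A x)
    -- The basis expansion of $Ax$ is grouped by energy; the group at $E$ sums to $P_EAx=f(E)P_Ex$.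
    refine HasSum.sigma ((Equiv.sigmaFiberEquiv en).hasSum_iff.mpr h) fun E => ?_
    have hP : ∀ α, S.energyProj N E (lp.single 2 α (A x α)) =
        if en α = E then lp.single 2 α (A x α) else 0 := fun α => by
      refine lp.ext (funext fun β => ?_)
      rw [S.isDiagonal_energyProj]
      by_cases hβ : β = α
      · subst hβ
        by_cases hE : en β = E
        · have : (S.energy β : ℂ) = E := congrArg Subtype.val hE
          simp [hE, this]
        · have : (S.energy β : ℂ) ≠ E := fun h => hE (Subtype.ext h)
          simp [hE, this]
      · split_ifs <;> simp [lp.single_apply, hβ]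
    have h1 := h.mapL (S.energyProj N E)
    have h2 : S.energyProj N E (A x) = f E • S.energyProj N E x := lp.ext (funext fun α => by
      rw [lp.coeFn_smul, Pi.smul_apply, S.isDiagonal_energyProj, S.isDiagonal_energyProj, hf]
      by_cases hE : (S.energy α : ℂ) = E
      · simp [hE]
      · simp [hE])
    rw [h2] at h1
    have h3 : HasSum (fun α => if en α = E then lp.single 2 α (A x α) else 0)
        (f E • S.energyProj N E x) := h1.congr_fun fun α => (hP α).symm
    have h4 := (hasSum_subtype_iff_of_support_subset (s := {α | en α = E}) fun α hα => by
      by_contra hne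
      exact hα (if_neg hne)).mpr h3
    exact h4.congr_fun fun α => (if_pos α.2).symm

/-! ### Equivalence classes and their projections -/

theorem Adjacent.energy_eq {S : SingleParticle H J} {α α' : Fin N → J} (h : S.Adjacent α α') :
    S.energy α = S.energy α' := by
  obtain ⟨i, j, hij, he, hk⟩ := h
  have hj : j ∈ Finset.univ.erase i := Finset.mem_erase.mpr ⟨hij.ne', Finset.mem_univ j⟩
  simp only [energy]
  rw [← Finset.add_sum_erase _ _ (Finset.mem_univ i), ← Finset.add_sum_erase _ _ hj,
    ← Finset.add_sum_erase _ (fun k => S.e (α' k)) (Finset.mem_univ i),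
    ← Finset.add_sum_erase _ (fun k => S.e (α' k)) hj, ← add_assoc, ← add_assoc, he]
  congr 1
  refine Finset.sum_congr rfl fun k hk' => ?_
  simp only [Finset.mem_erase] at hk'
  rw [hk k hk'.2.1 hk'.1]

/-- A function that takes equal values at adjacent indices is constant on equivalence classes. -/
theorem eq_of_indexSetoid {X : Type*} {f : (Fin N → J) → X}
    (hf : ∀ α α', S.Adjacent α α' → f α = f α') {α α' : Fin N → J}
    (h : S.indexSetoid N α α') : f α = f α' := by
  have h' : Relation.ReflTransGen S.Adjacent α α' := h
  induction h' with
  | refl => rfl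
  | tail h1 hbc ih => exact (ih h1).trans (hf _ _ hbc)

theorem energy_eq_of_indexSetoid {α α' : Fin N → J} (h : S.indexSetoid N α α') :
    S.energy α = S.energy α' :=
  S.eq_of_indexSetoid (fun _ _ => Adjacent.energy_eq) h

theorem finite_class (α₀ : Fin N → J) : {α | S.indexSetoid N α α₀}.Finite :=
  (S.finite_energy_le N (S.energy α₀)).subset fun _ hα => (S.energy_eq_of_indexSetoid hα).le

theorem isDiagonal_indexProj {c : Set (Fin N → J)} (hc : c.Finite) :
    IsDiagonal (S.indexProj c) (c.indicator 1) := by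
  classical
  intro x a
  have h1 : S.indexProj c = ∑ α ∈ hc.toFinset, InnerProductSpace.rankOne ℂ (S.Ψ α) (S.Ψ α) :=
    finsum_mem_eq_finite_toFinset_sum _ hc
  rw [h1, _root_.sum_apply, lp.coeFn_sum, Finset.sum_apply]
  have h2 : ∀ α, (InnerProductSpace.rankOne ℂ (S.Ψ α) (S.Ψ α) x) a =
      if α = a then x α else 0 := fun α => by
    rw [InnerProductSpace.rankOne_apply, Ψ_eq_single, lp.inner_single_left, lp.coeFn_smul,
      Pi.smul_apply, lp.single_apply]
    by_cases h : α = a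
    · subst h; simp
    · simp [h, Ne.symm h]
  simp only [h2, Finset.sum_ite_eq', Set.Finite.mem_toFinset]
  by_cases ha : a ∈ c <;> simp [ha]

theorem isDiagonal_indexProj_class (α₀ : Fin N → J) :
    IsDiagonal (S.indexProj {α | S.indexSetoid N α α₀})
      ({α | S.indexSetoid N α α₀}.indicator 1) :=
  S.isDiagonal_indexProj (S.finite_class α₀)

theorem indicator_class_congr (α₀ : Fin N → J) {α α' : Fin N → J} (h : S.Adjacent α α') :
    {α | S.indexSetoid N α α₀}.indicator (1 : (Fin N → J) → ℂ) α =
      {α | S.indexSetoid N α α₀}.indicator 1 α' := by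
  have h' : S.indexSetoid N α α' := Relation.ReflTransGen.single h
  by_cases hα : S.indexSetoid N α α₀
  · have hα' : S.indexSetoid N α' α₀ := (S.indexSetoid N).trans' ((S.indexSetoid N).symm' h') hα
    simp [hα, hα']
  · have hα' : ¬ S.indexSetoid N α' α₀ := fun h2 => hα ((S.indexSetoid N).trans' h' h2)
    simp [hα, hα']

theorem energyProj_eq_indexProj (E : ℂ) :
    S.energyProj N E = S.indexProj {α : Fin N → J | (S.energy α : ℂ) = E} := by
  refine (S.isDiagonal_energyProj N E).ext (S.isDiagonal_indexProj ?_)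
  refine (S.finite_energy_le N ‖E‖).subset fun α hα => ?_
  have hα' : (S.energy α : ℂ) = E := hα
  change S.energy α ≤ _
  rw [← hα', Complex.norm_real]
  exact Real.le_norm_self _

theorem indexProj_le_energyProj_iff {α₀ : Fin N → J} {E : ℂ} :
    S.indexProj {α | S.indexSetoid N α α₀} ≤ S.energyProj N E ↔ (S.energy α₀ : ℂ) = E := by
  rw [(S.isDiagonal_indexProj_class α₀).le_iff (S.isDiagonal_energyProj N E)]
  refine ⟨fun h => h ((S.indexSetoid N).refl' α₀), fun h α hα => ?_⟩
  change (S.energy α : ℂ) = E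
  rw [S.energy_eq_of_indexSetoid hα, h]

theorem Ψ_mem_hamiltonian_iff {α₀ : Fin N → J} {E : ℂ} :
    (S.Ψ α₀, E • S.Ψ α₀) ∈ S.hamiltonian N ↔ (S.energy α₀ : ℂ) = E := by
  constructor
  · intro h
    have := S.mem_hamiltonian.mp h α₀
    simp only [S.Ψ_eq_single, lp.coeFn_smul, Pi.smul_apply, lp.single_apply_self, smul_eq_mul,
      mul_one] at this
    exact this.symm
  · rintro rfl
    exact S.Ψ_mem_hamiltonian α₀

end SingleParticle

/-! ### The commutant, its minimal projections, and full ergodicity -/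

namespace CollisionSpecification

variable {H : Type*} [NormedAddCommGroup H] [InnerProductSpace ℂ H] [CompleteSpace H]
  {J : Type*} [LinearOrder J] [LocallyFiniteOrderBot J] {S : SingleParticle H J}
  {C : Type*} [MetricSpace C] [CompactSpace C] [MeasurableSpace C] [BorelSpace C]
  {K : CollisionSpecification S C} {N : ℕ}

theorem IsErgodic.compress_mem (hK : K.IsErgodic) {T : TensorPower J N →L[ℂ] TensorPower J N}
    (hT : T ∈ K.commutant N) {i j : Fin N} (hij : i < j) (α γ : Fin N → J) :
    ∃ f : ℂ → ℂ, IsDiagonal (compress hij.ne T α γ) fun β => f (S.energy β) := by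
  refine S.mem_energyAlgebra.mp ?_
  rw [← hK]
  rintro _ ⟨σ, rfl⟩
  exact compress_commute hij.ne (hT _ ⟨i, j, hij, σ, rfl⟩) α γ

/-- The element is an off-diagonal entry of a compression, which is diagonal; the indices outside
$i,j$ may agree or not. -/
theorem IsErgodic.apply_single_eq_zero (hK : K.IsErgodic)
    {T : TensorPower J N →L[ℂ] TensorPower J N} (hT : T ∈ K.commutant N) {i j : Fin N}
    (hij : i < j) {α γ : Fin N → J} (h : ![α i, α j] ≠ ![γ i, γ j]) :
    T (lp.single 2 γ 1) α = 0 := by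
  obtain ⟨f, hf⟩ := hK.compress_mem hT hij α γ
  rw [← compress_apply_single hij.ne, hf]
  simp [lp.single_apply, h]

/-- The commutant consists of the diagonal operators that are constant on equivalence classes. -/
theorem IsErgodic.mem_commutant (hK : K.IsErgodic) (hN : 2 ≤ N)
    {T : TensorPower J N →L[ℂ] TensorPower J N} :
    T ∈ K.commutant N ↔
      ∃ t, IsDiagonal T t ∧ ∀ α α', S.Adjacent α α' → t α = t α' := by
  constructor
  · intro hT
    refine ⟨_, isDiagonal_of_offDiag fun α γ hαγ => ?_, ?_⟩
    · obtain ⟨k, hk⟩ := Function.ne_iff.mp hαγ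
      have : Nontrivial (Fin N) := Fin.nontrivial_iff_two_le.mpr hN
      -- Since $N\ge2$, the differing entry $k$ has a partner $l$, and the pair $\{k,l\}$ detects
      -- the difference.
      obtain ⟨l, hl⟩ := exists_ne k
      rcases lt_or_gt_of_ne hl with hlk | hkl
      · exact hK.apply_single_eq_zero hT hlk fun h => hk (by simpa using congrFun h 1)
      · exact hK.apply_single_eq_zero hT hkl fun h => hk (by simpa using congrFun h 0)
    · rintro α α' ⟨i, j, hij, he, hk⟩
      obtain ⟨f, hf⟩ := hK.compress_mem hT hij α α
      have h1 := compress_apply_single hij.ne T α α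
      have h2 := compress_apply_single hij.ne T α' α'
      -- Adjacent indices share a fibre, so both diagonal elements are values of the same $f$, at
      -- equal two-particle energies.
      rw [← compress_congr hij.ne T hk] at h2
      rw [← h1, ← h2, hf.apply_single, hf.apply_single]
      simp [SingleParticle.energy, he]
  · rintro ⟨t, ht, hadj⟩ _ ⟨i, j, hij, σ, rfl⟩
    refine ht.commute_pairOp hij.ne fun α D hD => ?_
    -- Points of one fibre with equal two-particle energy are adjacent, so $t$ restricted to the
    -- fibre is a function of that energy.
    have hfac : (fun β : Fin 2 → J => t (insertPair i j α β)).FactorsThrough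
        fun β => (S.energy β : ℂ) := by
      intro β β' h
      refine hadj _ _ ⟨i, j, hij, ?_, fun k hi hj => ?_⟩
      · have h' : S.energy β = S.energy β' := Complex.ofReal_injective h
        simpa [SingleParticle.energy, insertPair, hij.ne] using h'
      · rw [insertPair_apply_of_ne α β hi hj, insertPair_apply_of_ne α β' hi hj]
    obtain ⟨f, hf⟩ := (Function.factorsThrough_iff _).mp hfac
    have hDm : D ∈ S.energyAlgebra 2 := by
      refine S.mem_energyAlgebra.mpr ⟨f, ?_⟩
      rw [hf] at hD
      exact hD
    rw [← hK] at hDm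
    exact hDm _ ⟨σ, rfl⟩

/-- The minimal projections are the projections onto the equivalence classes. -/
theorem IsErgodic.isMinimalProjection_iff (hK : K.IsErgodic) (hN : 2 ≤ N)
    {P : TensorPower J N →L[ℂ] TensorPower J N} :
    IsMinimalProjection (K.commutant N) P ↔
      ∃ α₀ : Fin N → J, P = S.indexProj {α | S.indexSetoid N α α₀} := by
  have hclass : ∀ α₀ : Fin N → J, S.indexProj {α | S.indexSetoid N α α₀} ∈ K.commutant N ∧
      IsStarProjection (S.indexProj {α | S.indexSetoid N α α₀}) ∧
      S.indexProj {α | S.indexSetoid N α α₀} ≠ 0 := fun α₀ =>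
    have h := S.isDiagonal_indexProj_class α₀
    ⟨(hK.mem_commutant hN).mpr ⟨_, h, fun _ _ => S.indicator_class_congr α₀⟩,
      h.isStarProjection, h.ne_zero_iff.mpr ⟨α₀, (S.indexSetoid N).refl' α₀⟩⟩
  -- A nonzero projection in the commutant is the indicator of a nonempty union of classes, so it
  -- dominates the class of any point of its support $d$.
  have hle : ∀ Q ∈ K.commutant N, IsStarProjection Q → Q ≠ 0 →
      ∃ α₀ : Fin N → J, S.indexProj {α | S.indexSetoid N α α₀} ≤ Q ∧
        ∃ d : Set (Fin N → J), IsDiagonal Q (d.indicator 1) ∧ α₀ ∈ d := by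
    intro Q hQ hQp hQ0
    obtain ⟨t, ht, hadj⟩ := (hK.mem_commutant hN).mp hQ
    have hd := ht.eq_indicator hQp
    obtain ⟨α₀, hα₀⟩ := hd.ne_zero_iff.mp hQ0
    refine ⟨α₀, ((S.isDiagonal_indexProj_class α₀).le_iff hd).mpr fun α hα => ?_, _, hd, hα₀⟩
    change t α ≠ 0
    rwa [S.eq_of_indexSetoid hadj hα]
  constructor
  · rintro ⟨hP, hPp, hP0, hmin⟩
    obtain ⟨α₀, h, -⟩ := hle P hP hPp hP0
    exact ⟨α₀, (hmin _ (hclass α₀).1 (hclass α₀).2.1 (hclass α₀).2.2 h).symm⟩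
  · rintro ⟨α₀, rfl⟩
    refine ⟨(hclass α₀).1, (hclass α₀).2.1, (hclass α₀).2.2, fun Q hQ hQp hQ0 hQle => ?_⟩
    obtain ⟨α₁, h, d, hd, hα₁⟩ := hle Q hQ hQp hQ0
    -- The support of $Q$ lies in the class of $\alpha_0$, so the class found inside $Q$ is that
    -- same class.
    have h10 : S.indexSetoid N α₁ α₀ :=
      (hd.le_iff (S.isDiagonal_indexProj_class α₀)).mp hQle hα₁
    refine le_antisymm hQle (le_trans (le_of_eq ?_) h)
    congr 1
    ext α
    exact ⟨fun h' => (S.indexSetoid N).trans' h' ((S.indexSetoid N).symm' h10),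
      fun h' => (S.indexSetoid N).trans' h' h10⟩

/-- $P_E$ is the indicator of a whole energy level, so it is minimal exactly when that level is a
single class. -/
theorem IsErgodic.isFullyErgodic_iff (hK : K.IsErgodic) (hN : 2 ≤ N) :
    K.IsFullyErgodic N ↔
      ∀ α α' : Fin N → J, S.energy α = S.energy α' → S.indexSetoid N α α' := by
  constructor
  · rintro ⟨-, h⟩ α α' hα
    obtain ⟨α₀, hP⟩ := (hK.isMinimalProjection_iff hN).mp
      (h (S.energy α') (S.mem_spec.mpr ⟨α', rfl⟩))
    have hsub := ((S.isDiagonal_energyProj N (S.energy α')).le_iff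
      (S.isDiagonal_indexProj_class α₀)).mp hP.le
    have h1 : S.indexSetoid N α α₀ := hsub (by simp [hα])
    have h2 : S.indexSetoid N α' α₀ := hsub (by simp)
    exact (S.indexSetoid N).trans' h1 ((S.indexSetoid N).symm' h2)
  · refine fun h => ⟨hK, fun E hE => (hK.isMinimalProjection_iff hN).mpr ?_⟩
    obtain ⟨α₀, rfl⟩ := S.mem_spec.mp hE
    refine ⟨α₀, ?_⟩
    rw [S.energyProj_eq_indexProj]
    congr 1
    ext α
    exact ⟨fun hα => h _ _ (Complex.ofReal_injective hα),
      fun hα => congrArg _ (S.energy_eq_of_indexSetoid hα)⟩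

/-- If the algebras agree, the projection onto a class is a function of the energy, so the class
fills its level. Conversely, if levels are classes, being constant on classes means being a function
of the energy. -/
theorem IsErgodic.commutant_eq_energyAlgebra_iff (hK : K.IsErgodic) (hN : 2 ≤ N) :
    K.commutant N = S.energyAlgebra N ↔
      ∀ α α' : Fin N → J, S.energy α = S.energy α' → S.indexSetoid N α α' := by
  constructor
  · intro h α α' hα
    have hm := ((hK.isMinimalProjection_iff hN).mpr ⟨α', rfl⟩).1
    rw [h] at hm
    obtain ⟨f, hf⟩ := S.mem_energyAlgebra.mp hm
    have hu := hf.unique (S.isDiagonal_indexProj_class α')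
    have h1 := congrFun hu α
    have h2 := congrFun hu α'
    simp only [hα] at h1
    by_contra hn
    rw [h1] at h2
    simp [hn] at h2
  · intro h
    ext T
    rw [hK.mem_commutant hN, S.mem_energyAlgebra]
    constructor
    · rintro ⟨t, ht, hadj⟩
      have hfac : t.FactorsThrough fun α : Fin N → J => (S.energy α : ℂ) := fun α α' hα =>
        S.eq_of_indexSetoid hadj (h _ _ (Complex.ofReal_injective hα))
      obtain ⟨f, rfl⟩ := (Function.factorsThrough_iff _).mp hfac
      exact ⟨f, ht⟩
    · rintro ⟨f, hf⟩
      exact ⟨_, hf, fun α α' hα => by rw [hα.energy_eq]⟩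

end CollisionSpecification

end QuantumKac

end

theorem lemma2p14
    {H : Type*} [NormedAddCommGroup H] [InnerProductSpace ℂ H] [CompleteSpace H]
    {J : Type*} [LinearOrder J] [LocallyFiniteOrderBot J] (S : QuantumKac.SingleParticle H J)
    {C : Type*} [MetricSpace C] [CompactSpace C] [MeasurableSpace C] [BorelSpace C]
    (K : QuantumKac.CollisionSpecification S C) (hK : K.IsErgodic) (N : ℕ) (hN : 2 ≤ N) :
    -- the equivalence classes are finite
    (∀ c ∈ (S.indexSetoid N).classes, c.Finite) ∧
    -- the minimal projections below `P_E`
    (∀ E ∈ S.spec N, ∀ P : QuantumKac.TensorPower J N →L[ℂ] QuantumKac.TensorPower J N,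
      (QuantumKac.IsMinimalProjection (K.commutant N) P ∧ P ≤ S.energyProj N E) ↔
        ∃ α₀ : Fin N → J, (S.Ψ α₀, E • S.Ψ α₀) ∈ S.hamiltonian N ∧
          P = S.indexProj {α | (S.indexSetoid N) α α₀}) ∧
    -- each minimal projection lies below some `P_E`
    (∀ P, QuantumKac.IsMinimalProjection (K.commutant N) P →
      ∃ E ∈ S.spec N, P ≤ S.energyProj N E) ∧
    -- minimal projections correspond one-to-one to equivalence classes
    Set.BijOn S.indexProj (S.indexSetoid N).classes
      {P | QuantumKac.IsMinimalProjection (K.commutant N) P} ∧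
    -- full ergodicity
    (K.IsFullyErgodic N ↔
      ∀ α α' : Fin N → J, S.energy α = S.energy α' → (S.indexSetoid N) α α') ∧
    (K.commutant N = S.energyAlgebra N ↔
      ∀ α α' : Fin N → J, S.energy α = S.energy α' → (S.indexSetoid N) α α') := by
  refine ⟨?_, fun E _ P => ⟨?_, ?_⟩, fun P hP => ?_, ⟨?_, ?_, ?_⟩,
    hK.isFullyErgodic_iff hN, hK.commutant_eq_energyAlgebra_iff hN⟩
  · rintro _ ⟨α₀, rfl⟩
    exact S.finite_class α₀
  · rintro ⟨hP, hle⟩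
    obtain ⟨α₀, rfl⟩ := (hK.isMinimalProjection_iff hN).mp hP
    exact ⟨α₀, S.Ψ_mem_hamiltonian_iff.mpr (S.indexProj_le_energyProj_iff.mp hle), rfl⟩
  · rintro ⟨α₀, hα₀, rfl⟩
    exact ⟨(hK.isMinimalProjection_iff hN).mpr ⟨α₀, rfl⟩,
      S.indexProj_le_energyProj_iff.mpr (S.Ψ_mem_hamiltonian_iff.mp hα₀)⟩
  · obtain ⟨α₀, rfl⟩ := (hK.isMinimalProjection_iff hN).mp hP
    exact ⟨S.energy α₀, S.mem_spec.mpr ⟨α₀, rfl⟩, S.indexProj_le_energyProj_iff.mpr rfl⟩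
  · rintro _ ⟨α₀, rfl⟩
    exact (hK.isMinimalProjection_iff hN).mpr ⟨α₀, rfl⟩
  · rintro _ ⟨α₀, rfl⟩ _ ⟨α₁, rfl⟩ h
    have h0 := S.isDiagonal_indexProj_class α₀
    have h1 := S.isDiagonal_indexProj_class α₁
    -- Equal projections dominate each other, which gives both inclusions of the classes.
    exact ((h0.le_iff h1).mp h.le).antisymm ((h1.le_iff h0).mp h.ge)
  · intro P hP
    obtain ⟨α₀, rfl⟩ := (hK.isMinimalProjection_iff hN).mp hP
    exact ⟨_, ⟨α₀, rfl⟩, rfl⟩
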